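/- Let $s\in(0,1)$ and, for $n=2$, put $$g(\rho)=\frac{1}{(1+\rho^2)^{\frac{n+s+1}{2}}},\qquad G(\tau)=\int_0^\tau g(\rho)\,d\rho,\qquad \mathcal G(t)=\int_0^t G(\tau)\,d\tau .$$ Let $M\ge 1$ and let $W:\mathbb R\to[0,\infty)$ satisfy $W\in C^2([-M,M])$ and $W(1)=W(-1)=0$. For $R>0$ let $B_R=\{x\in\mathbb R^2: |x|<R\}$, let $\mathcal CB_R=\mathbb R^2\setminus B_R$, and for measurable $v:\mathbb R^2\to\mathbb R$ set $$\mathcal E(v,B_R)=\iint_{\mathbb R^{4}\setminus(\mathcal CB_R)^2}\frac{1}{|x-y|^{n+s-1}}\,\mathcal G\!\left(\frac{v(x)-v(y)}{|x-y|}\right)dx\,dy+\int_{B_R}W(v)\,dx\in[0,\infty].$$ Let $u:\mathbb R^2\to\mathbb R$ be continuous with $|u|\le M$, and suppose that $u$ is a minimizer of this energy in every ball, that is, for every $R>0$ one has $\mathcal E(u,B_R)<\infty$ and $\mathcal E(u,B_R)\le\mathcal E(v,B_R)$ for every measurable $v:\mathbb R^2\to\mathbb R$ with $v=u$ almost everywhere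 in $\mathcal CB_R$. Then $u$ is one-dimensional: there exist $\omega\in\mathbb R^2$ with $|\omega|=1$ and $u_0:\mathbb R\to\mathbb R$ such that $$u(x)=u_0(\omega\cdot x)\qquad\text{for all }x\in\mathbb R^2 .$$ -/

import Mathlib

open MeasureTheory Set

noncomputable section

namespace FracMeanCurv

/-- `g(ρ) = (1 + ρ²)^{-(n+s+1)/2}`. -/
def g (n : ℕ) (s ρ : ℝ) : ℝ := 1 / (1 + ρ ^ 2) ^ (((n : ℝ) + s + 1) / 2)

/-- The primitive `G(τ) = ∫₀^τ g(ρ) dρ`. -/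
def G (n : ℕ) (s τ : ℝ) : ℝ := ∫ ρ in (0 : ℝ)..τ, g n s ρ

/-- The double primitive `𝒢(t) = ∫₀^t G(τ) dτ`. -/
def GG (n : ℕ) (s t : ℝ) : ℝ := ∫ τ in (0 : ℝ)..t, G n s τ

/-- `F(t, x) = |x|^{-(n+s-1)} 𝒢(t / |x|)`; it is only meant for `x ≠ 0`, which is all that matters
for the energy, as the diagonal `x = y` has measure zero. -/
def F (n : ℕ) (s t : ℝ) (x : EuclideanSpace ℝ (Fin n)) : ℝ :=
  1 / ‖x‖ ^ ((n : ℝ) + s - 1) * GG n s (t / ‖x‖)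

/-- The energy
`∬_{ℝ²ⁿ \ (CB_R)²} F(u(x) - u(y), x - y) dx dy + ∫_{B_R} W(u) dx`,
with `B_R` the open ball of radius `R` centred at the origin and `CB_R` its complement.
For `W ≥ 0` both integrands are nonnegative, so the energy is an element of `[0, ∞]`. -/
def energy (n : ℕ) (s : ℝ) (W : ℝ → ℝ) (u : EuclideanSpace ℝ (Fin n) → ℝ) (R : ℝ) : ENNReal :=
  (∫⁻ z in ((Metric.ball (0 : EuclideanSpace ℝ (Fin n)) R)ᶜ ×ˢ
      (Metric.ball (0 : EuclideanSpace ℝ (Fin n)) R)ᶜ)ᶜ,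
      ENNReal.ofReal (F n s (u z.1 - u z.2) (z.1 - z.2)))
    + ∫⁻ x in Metric.ball (0 : EuclideanSpace ℝ (Fin n)) R, ENNReal.ofReal (W (u x))

/-- `u` is a minimizer of the energy in `B_R`: it is measurable, has finite energy, and has no
larger energy than any measurable `v` that equals `u` almost everywhere outside `B_R`. -/
def IsMinimizer (n : ℕ) (s : ℝ) (W : ℝ → ℝ) (u : EuclideanSpace ℝ (Fin n) → ℝ) (R : ℝ) : Prop :=
  Measurable u ∧ energy n s W u R < ⊤ ∧
    ∀ v : EuclideanSpace ℝ (Fin n) → ℝ, Measurable v →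
      (∀ᵐ x, x ∉ Metric.ball (0 : EuclideanSpace ℝ (Fin n)) R → u x = v x) →
      energy n s W u R ≤ energy n s W v R

end FracMeanCurv

end

noncomputable section

namespace FracMeanCurv

/-! A minimizer cannot cross any of its translates, and a continuous function on the plane that is
comparable with all its translates is one-dimensional.

To see that crossing is impossible, translate by `h` inside a large ball only: with a cutoff `ψ`
equal to `‖h‖` on `B_{R/2}`, vanishing outside `B_R` and of slope `δ = O(1/R)`, move `u` by the
shears `x ↦ x ± ψ(x) e`. In the sum of the two energies the first-order terms cancel, so the sum
exceeds `2 E(u)` by at most `100 δ² E(u)` (`energy_shear_add_le`). Comparison with a constant gives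
`E(u, B_R) ≤ C R^(2 - s/2)` (`exists_energy_le`), so the excess is `O(R^(-s/2))`; this is where
dimension two enters.

On the other hand, replacing `u` and its sheared copy by their minimum and maximum never increases
the total energy, and strict convexity of `GG` yields a gain wherever the two graphs cross
(`F_cross_lt`). If `u` and `u(· - h)` cross, this gain is bounded below by a positive number
independent of `R`. Minimality bounds it above by the excess (`crossing_le_energy`), and `R → ∞`
gives a contradiction. -/

/-! ### The primitives `G` and `GG`: parity, convexity, growth. -/

lemma g_pos (n : ℕ) (s ρ : ℝ) : 0 < g n s ρ := by
  unfold g; positivity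

lemma continuous_g (n : ℕ) (s : ℝ) : Continuous (g n s) := by
  unfold g
  refine Continuous.div continuous_const ?_ (fun x => by positivity)
  exact Continuous.rpow_const (by fun_prop) (fun x => Or.inl (by positivity))

lemma g_neg (n : ℕ) (s ρ : ℝ) : g n s (-ρ) = g n s ρ := by simp [g]

lemma hasDerivAt_G (n : ℕ) (s τ : ℝ) : HasDerivAt (G n s) (g n s τ) τ :=
  intervalIntegral.integral_hasDerivAt_right ((continuous_g n s).intervalIntegrable _ _)
    ((continuous_g n s).stronglyMeasurableAtFilter _ _) (continuous_g n s).continuousAt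

lemma continuous_G (n : ℕ) (s : ℝ) : Continuous (G n s) :=
  continuous_iff_continuousAt.2 fun τ => (hasDerivAt_G n s τ).continuousAt

lemma hasDerivAt_GG (n : ℕ) (s t : ℝ) : HasDerivAt (GG n s) (G n s t) t :=
  intervalIntegral.integral_hasDerivAt_right ((continuous_G n s).intervalIntegrable _ _)
    ((continuous_G n s).stronglyMeasurableAtFilter _ _) (continuous_G n s).continuousAt

lemma continuous_GG (n : ℕ) (s : ℝ) : Continuous (GG n s) :=
  continuous_iff_continuousAt.2 fun τ => (hasDerivAt_GG n s τ).continuousAt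

lemma strictMono_G (n : ℕ) (s : ℝ) : StrictMono (G n s) :=
  strictMono_of_deriv_pos fun x => by rw [(hasDerivAt_G n s x).deriv]; exact g_pos n s x

lemma G_zero (n : ℕ) (s : ℝ) : G n s 0 = 0 := by simp [G]

lemma GG_zero (n : ℕ) (s : ℝ) : GG n s 0 = 0 := by simp [GG]

lemma G_neg (n : ℕ) (s τ : ℝ) : G n s (-τ) = -G n s τ := by
  have h := intervalIntegral.integral_comp_neg (a := 0) (b := τ) (fun ρ => g n s ρ)
  simp only [g_neg, neg_zero] at h
  rw [G, G, h, intervalIntegral.integral_symm]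

lemma GG_neg (n : ℕ) (s t : ℝ) : GG n s (-t) = GG n s t := by
  have h := intervalIntegral.integral_comp_neg (a := 0) (b := t) (fun ρ => G n s ρ)
  simp only [G_neg, neg_zero, intervalIntegral.integral_neg] at h
  rw [GG, GG, intervalIntegral.integral_symm, ← h, neg_neg]

lemma GG_abs (n : ℕ) (s t : ℝ) : GG n s |t| = GG n s t := by
  rcases abs_choice t with h | h <;> rw [h]
  exact GG_neg n s t

lemma strictConvexOn_GG (n : ℕ) (s : ℝ) : StrictConvexOn ℝ univ (GG n s) := by
  refine StrictMonoOn.strictConvexOn_of_deriv convex_univ (continuous_GG n s).continuousOn ?_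
  have : deriv (GG n s) = G n s := funext fun x => (hasDerivAt_GG n s x).deriv
  rw [this]
  exact (strictMono_G n s).strictMonoOn _

lemma GG_nonneg (n : ℕ) (s t : ℝ) : 0 ≤ GG n s t := by
  rw [← GG_abs]
  refine intervalIntegral.integral_nonneg (abs_nonneg t) fun τ hτ => ?_
  rw [← G_zero n s]
  exact (strictMono_G n s).monotone hτ.1

/-- The exponent `(n+s+1)/2` is at least `1`, so `g` lies below the derivative of the arctangent.
Hence `GG` grows at most linearly. -/
lemma abs_G_le {n : ℕ} {s : ℝ} (hn : 1 ≤ n) (hs : 0 ≤ s) (τ : ℝ) : |G n s τ| ≤ Real.pi / 2 := by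
  have key : ∀ τ, 0 ≤ τ → |G n s τ| ≤ Real.pi / 2 := by
    intro τ hτ
    have h0 : 0 ≤ G n s τ := by
      rw [← G_zero n s]; exact (strictMono_G n s).monotone hτ
    rw [abs_of_nonneg h0]
    calc G n s τ ≤ ∫ ρ in (0 : ℝ)..τ, (1 + ρ ^ 2)⁻¹ := by
          refine intervalIntegral.integral_mono_on hτ ((continuous_g n s).intervalIntegrable _ _)
            (Continuous.intervalIntegrable ?_ _ _) fun ρ _ => ?_
          · exact Continuous.inv₀ (by fun_prop) (fun x => by positivity)
          · rw [g, one_div]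
            refine inv_anti₀ (by positivity) ?_
            refine Real.self_le_rpow_of_one_le (by nlinarith [sq_nonneg ρ]) ?_
            have : (1 : ℝ) ≤ n := by exact_mod_cast hn
            linarith
      _ ≤ Real.pi / 2 := by
          rw [integral_inv_one_add_sq]
          simpa using (Real.arctan_lt_pi_div_two τ).le
  rcases le_total 0 τ with h | h
  · exact key τ h
  · have := key (-τ) (by linarith)
    rwa [G_neg, abs_neg] at this

lemma GG_le {n : ℕ} {s : ℝ} (hn : 1 ≤ n) (hs : 0 ≤ s) (t : ℝ) :
    GG n s t ≤ Real.pi / 2 * |t| := by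
  have := intervalIntegral.norm_integral_le_of_norm_le_const (a := 0) (b := t)
    (f := G n s) (C := Real.pi / 2) (fun x _ => abs_G_le hn hs x)
  rw [sub_zero] at this
  exact (le_abs_self _).trans this

/-! ### The interaction kernel `F`. -/

section F

variable {n : ℕ} {s : ℝ}

lemma F_nonneg (t : ℝ) (x : EuclideanSpace ℝ (Fin n)) : 0 ≤ F n s t x :=
  mul_nonneg (by positivity) (GG_nonneg n s _)

lemma F_neg (t : ℝ) (x : EuclideanSpace ℝ (Fin n)) : F n s (-t) x = F n s t x := by
  rw [F, F, neg_div, GG_neg]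

lemma F_abs (t : ℝ) (x : EuclideanSpace ℝ (Fin n)) : F n s |t| x = F n s t x := by
  rcases abs_choice t with h | h <;> rw [h]
  exact F_neg t x

lemma F_zero (x : EuclideanSpace ℝ (Fin n)) : F n s 0 x = 0 := by
  simp [F, GG_zero]

/-- Linear growth of `GG` reduces the interaction of bounded functions to the fractional perimeter
kernel `|x|^{-(n+s)}`. -/
lemma F_le (hn : 1 ≤ n) (hs : 0 ≤ s) (t : ℝ) {x : EuclideanSpace ℝ (Fin n)} (hx : x ≠ 0) :
    F n s t x ≤ Real.pi / 2 * |t| * ‖x‖ ^ (-((n : ℝ) + s)) := by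
  have hr : 0 < ‖x‖ := norm_pos_iff.2 hx
  calc F n s t x ≤ 1 / ‖x‖ ^ ((n : ℝ) + s - 1) * (Real.pi / 2 * |t / ‖x‖|) :=
        mul_le_mul_of_nonneg_left (GG_le hn hs _) (by positivity)
    _ = _ := by
        rw [abs_div, abs_of_pos hr, Real.rpow_neg hr.le, Real.rpow_sub_one hr.ne']
        field_simp

lemma measurable_F : Measurable fun q : ℝ × EuclideanSpace ℝ (Fin n) => F n s q.1 q.2 := by
  unfold F
  have := (continuous_GG n s).measurable
  refine Measurable.mul (Measurable.div measurable_const ?_) (this.comp ?_) <;> fun_prop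

/-- `F` as an iterated integral of the kernel `(|x|² + σ²)^{-(n+s+1)/2}`. -/
lemma F_eq_integral (a : ℝ) {x : EuclideanSpace ℝ (Fin n)} (hx : x ≠ 0) :
    F n s a x =
      ∫ τ in (0 : ℝ)..a, ∫ σ in (0 : ℝ)..τ, (‖x‖ ^ 2 + σ ^ 2) ^ (-(((n : ℝ) + s + 1) / 2)) := by
  have hr : 0 < ‖x‖ := norm_pos_iff.2 hx
  set r := ‖x‖ with hrdef
  have h1 : ∀ σ : ℝ, (r ^ 2 + σ ^ 2) ^ (-(((n : ℝ) + s + 1) / 2))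
      = r ^ (-((n : ℝ) + s + 1)) * g n s (σ / r) := by
    intro σ
    have : r ^ 2 + σ ^ 2 = r ^ 2 * (1 + (σ / r) ^ 2) := by field_simp
    rw [this, Real.mul_rpow (by positivity) (by positivity), g, one_div, ← Real.rpow_neg (by positivity),
      ← Real.rpow_natCast r 2, ← Real.rpow_mul hr.le]
    congr 2
    push_cast; ring
  have h2 : ∀ τ : ℝ, ∫ σ in (0 : ℝ)..τ, (r ^ 2 + σ ^ 2) ^ (-(((n : ℝ) + s + 1) / 2))
      = r ^ (-((n : ℝ) + s + 1)) * (r * G n s (τ / r)) := by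
    intro τ
    simp_rw [h1]
    rw [intervalIntegral.integral_const_mul, intervalIntegral.integral_comp_div (g n s) hr.ne']
    simp [G]
  simp_rw [h2]
  rw [intervalIntegral.integral_const_mul, intervalIntegral.integral_const_mul,
    intervalIntegral.integral_comp_div (G n s) hr.ne', F, ← hrdef, zero_div, smul_eq_mul, GG,
    Real.rpow_neg hr.le, Real.rpow_add_one hr.ne', Real.rpow_sub_one hr.ne']
  field_simp

end F

/-! ### Second-order estimates for opposite perturbations. -/

/-- Bernoulli's inequality followed by `1/(1+y) ≤ 1 - y + 2y²` for `y = pα ≥ -1/2`; the constant `8`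
is `2p²` at `p = 2`. -/
lemma rpow_neg_one_add_le {p α : ℝ} (hp1 : 1 ≤ p) (hp2 : p ≤ 2) (hα : |α| ≤ 1 / 4) :
    (1 + α) ^ (-p) ≤ 1 - p * α + 8 * α ^ 2 := by
  obtain ⟨h1, h2⟩ := abs_le.1 hα
  have hpos : 1 / 2 ≤ 1 + p * α := by nlinarith
  rw [Real.rpow_neg (by linarith)]
  have hB := one_add_mul_self_le_rpow_one_add (s := α) (by linarith) hp1
  calc ((1 + α) ^ p)⁻¹ ≤ (1 + p * α)⁻¹ := inv_anti₀ (by linarith) hB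
    _ ≤ 1 - p * α + 2 * (p * α) ^ 2 := by
        rw [inv_le_iff_one_le_mul₀ (by linarith)]
        nlinarith [mul_nonneg (sq_nonneg (p * α)) (by linarith : 0 ≤ 1 + 2 * (p * α))]
    _ ≤ _ := by
        nlinarith [mul_nonneg (sq_nonneg α) (by nlinarith : (0 : ℝ) ≤ 4 - p ^ 2)]

/-- The two summands are exchanged by changing the signs of `α`, `ε₁`, `ε₂`, so all odd-order terms
cancel and only products of two small quantities survive. The constant `100` is not sharp. -/
lemma perturbed_rpow_add_le {p α δ ε₁ ε₂ q q₁ q₂ : ℝ} (hp1 : 1 ≤ p) (hp2 : p ≤ 2) (hδ : δ ≤ 1 / 8)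
    (hα : |α| ≤ 2 * δ) (h₁ : |ε₁| ≤ δ) (h₂ : |ε₂| ≤ δ) (hq : 0 < q)
    (hq₁ : q * (1 + α) ≤ q₁) (hq₂ : q * (1 - α) ≤ q₂) :
    ((1 + ε₁) * (1 + ε₂)) * q₁ ^ (-p) + ((1 - ε₁) * (1 - ε₂)) * q₂ ^ (-p)
      ≤ (2 + 100 * δ ^ 2) * q ^ (-p) := by
  have hδ0 : 0 ≤ δ := (abs_nonneg _).trans h₁
  have hα' : |α| ≤ 1 / 4 := by linarith
  have hα'' : |-α| ≤ 1 / 4 := by rwa [abs_neg]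
  obtain ⟨a1, a2⟩ := abs_le.1 hα'
  obtain ⟨b1, b2⟩ := abs_le.1 h₁
  obtain ⟨c1, c2⟩ := abs_le.1 h₂
  have e1 : q₁ ^ (-p) ≤ q ^ (-p) * (1 - p * α + 8 * α ^ 2) := by
    calc q₁ ^ (-p) ≤ (q * (1 + α)) ^ (-p) :=
          Real.rpow_le_rpow_of_nonpos (mul_pos hq (by linarith)) hq₁ (by linarith)
      _ = q ^ (-p) * (1 + α) ^ (-p) := Real.mul_rpow hq.le (by linarith)
      _ ≤ _ := mul_le_mul_of_nonneg_left (rpow_neg_one_add_le hp1 hp2 hα') (by positivity)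
  have e2 : q₂ ^ (-p) ≤ q ^ (-p) * (1 + p * α + 8 * α ^ 2) := by
    calc q₂ ^ (-p) ≤ (q * (1 + -α)) ^ (-p) :=
          Real.rpow_le_rpow_of_nonpos (mul_pos hq (by linarith)) (by rwa [← sub_eq_add_neg])
            (by linarith)
      _ = q ^ (-p) * (1 + -α) ^ (-p) := Real.mul_rpow hq.le (by linarith)
      _ ≤ q ^ (-p) * (1 - p * (-α) + 8 * (-α) ^ 2) :=
          mul_le_mul_of_nonneg_left (rpow_neg_one_add_le hp1 hp2 hα'') (by positivity)
      _ = _ := by ring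
  have hA : 0 ≤ (1 + ε₁) * (1 + ε₂) := mul_nonneg (by linarith) (by linarith)
  have hB : 0 ≤ (1 - ε₁) * (1 - ε₂) := mul_nonneg (by linarith) (by linarith)
  have hα2 : α ^ 2 ≤ 4 * δ ^ 2 := by
    have := sq_le_sq' (neg_le_of_abs_le hα) (le_of_abs_le hα); linarith
  have hε : ε₁ * ε₂ ≤ δ ^ 2 := by
    calc ε₁ * ε₂ ≤ |ε₁ * ε₂| := le_abs_self _
      _ = |ε₁| * |ε₂| := abs_mul _ _
      _ ≤ δ * δ := mul_le_mul h₁ h₂ (abs_nonneg _) hδ0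
      _ = _ := by ring
  have hαε : -(p * α * (ε₁ + ε₂)) ≤ 2 * (2 * δ) * (2 * δ) := by
    calc -(p * α * (ε₁ + ε₂)) ≤ |p * α * (ε₁ + ε₂)| := neg_le_abs _
      _ = |p| * |α| * |ε₁ + ε₂| := by rw [abs_mul, abs_mul]
      _ ≤ 2 * (2 * δ) * (2 * δ) := by
          have : |p| ≤ 2 := abs_le.2 ⟨by linarith, hp2⟩
          have h3 : |ε₁ + ε₂| ≤ 2 * δ := (abs_add_le _ _).trans (by linarith)
          gcongr
  have hfin : (1 + ε₁) * (1 + ε₂) * (1 - p * α + 8 * α ^ 2)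
      + (1 - ε₁) * (1 - ε₂) * (1 + p * α + 8 * α ^ 2) ≤ 2 + 100 * δ ^ 2 := by
    have h5 : (1 + ε₁ * ε₂) * (1 + 8 * α ^ 2) ≤ (1 + δ ^ 2) * (1 + 8 * (4 * δ ^ 2)) := by
      gcongr
    have h6 : δ ^ 2 * δ ^ 2 ≤ δ ^ 2 * (1 / 64) := by
      apply mul_le_mul_of_nonneg_left _ (sq_nonneg δ); nlinarith
    nlinarith
  calc _ ≤ (1 + ε₁) * (1 + ε₂) * (q ^ (-p) * (1 - p * α + 8 * α ^ 2))
        + (1 - ε₁) * (1 - ε₂) * (q ^ (-p) * (1 + p * α + 8 * α ^ 2)) := by gcongr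
    _ = ((1 + ε₁) * (1 + ε₂) * (1 - p * α + 8 * α ^ 2)
      + (1 - ε₁) * (1 - ε₂) * (1 + p * α + 8 * α ^ 2)) * q ^ (-p) := by ring
    _ ≤ _ := by gcongr

/-- Second-order stability of `F` under opposite perturbations of the space variable, weighted by
Jacobian-type factors. -/
lemma perturbed_F_add_le {s : ℝ} (hs0 : 0 < s) (hs1 : s < 1) {δ ε₁ ε₂ : ℝ} (hδ : δ ≤ 1 / 8)
    (h₁ : |ε₁| ≤ δ) (h₂ : |ε₂| ≤ δ) (a : ℝ) {z η : EuclideanSpace ℝ (Fin 2)} (hη : ‖η‖ ≤ δ * ‖z‖) :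
    ((1 + ε₁) * (1 + ε₂)) * F 2 s a (z + η) + ((1 - ε₁) * (1 - ε₂)) * F 2 s a (z - η)
      ≤ (2 + 100 * δ ^ 2) * F 2 s a z := by
  have hδ0 : 0 ≤ δ := (abs_nonneg _).trans h₁
  rcases eq_or_ne z 0 with rfl | hz
  · have h0 : η = 0 := by simpa using hη
    have : F 2 s a (0 : EuclideanSpace ℝ (Fin 2)) = 0 := by
      have : (2 : ℝ) + s - 1 ≠ 0 := by linarith
      simp [F, Real.zero_rpow this]
    simp [h0, this]
  have hzp : 0 < ‖z‖ := norm_pos_iff.2 hz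
  have hne : ∀ w : EuclideanSpace ℝ (Fin 2), ‖w‖ ≤ δ * ‖z‖ → z + w ≠ 0 := by
    intro w hw h
    have : ‖z‖ = ‖w‖ := by rw [eq_neg_of_add_eq_zero_left h, norm_neg]
    nlinarith
  have hp : z + η ≠ 0 := hne η hη
  have hm : z - η ≠ 0 := by rw [sub_eq_add_neg]; exact hne _ (by rwa [norm_neg])
  -- With `|a|` in place of `a` both nested integrals run over ordered intervals, and the claim
  -- reduces to the pointwise bound on the kernel `(|z|² + σ²)^{-p}`.
  rw [← F_abs a, ← F_abs a, ← F_abs a]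
  rw [F_eq_integral _ hp, F_eq_integral _ hm, F_eq_integral _ hz]
  set p : ℝ := (((2 : ℕ) : ℝ) + s + 1) / 2 with hpdef
  have hp1 : 1 ≤ p := by rw [hpdef]; push_cast; linarith
  have hp2 : p ≤ 2 := by rw [hpdef]; push_cast; linarith
  have hc : ∀ w : EuclideanSpace ℝ (Fin 2), w ≠ 0 →
      Continuous fun σ : ℝ => (‖w‖ ^ 2 + σ ^ 2) ^ (-p) := by
    intro w hw
    have : 0 < ‖w‖ := norm_pos_iff.2 hw
    exact Continuous.rpow_const (by fun_prop) (fun x => Or.inl (by positivity))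
  have hcI : ∀ w : EuclideanSpace ℝ (Fin 2), w ≠ 0 →
      Continuous fun τ : ℝ => ∫ σ in (0 : ℝ)..τ, (‖w‖ ^ 2 + σ ^ 2) ^ (-p) := fun w hw =>
    intervalIntegral.continuous_primitive (fun a b => (hc w hw).intervalIntegrable a b) 0
  have i1 := fun a b => (hc _ hp).intervalIntegrable (μ := volume) a b
  have i2 := fun a b => (hc _ hm).intervalIntegrable (μ := volume) a b
  have i3 := fun a b => (hc _ hz).intervalIntegrable (μ := volume) a b
  have j1 := fun a b => (hcI _ hp).intervalIntegrable (μ := volume) a b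
  have j2 := fun a b => (hcI _ hm).intervalIntegrable (μ := volume) a b
  have j3 := fun a b => (hcI _ hz).intervalIntegrable (μ := volume) a b
  rw [← intervalIntegral.integral_const_mul, ← intervalIntegral.integral_const_mul,
    ← intervalIntegral.integral_const_mul,
    ← intervalIntegral.integral_add ((j1 _ _).const_mul _) ((j2 _ _).const_mul _)]
  refine intervalIntegral.integral_mono_on (abs_nonneg a)
    (((j1 _ _).const_mul _).add ((j2 _ _).const_mul _)) ((j3 _ _).const_mul _) fun τ hτ => ?_
  rw [← intervalIntegral.integral_const_mul, ← intervalIntegral.integral_const_mul,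
    ← intervalIntegral.integral_const_mul,
    ← intervalIntegral.integral_add ((i1 _ _).const_mul _) ((i2 _ _).const_mul _)]
  refine intervalIntegral.integral_mono_on hτ.1
    (((i1 _ _).const_mul _).add ((i2 _ _).const_mul _)) ((i3 _ _).const_mul _) fun σ _ => ?_
  have hq : 0 < ‖z‖ ^ 2 + σ ^ 2 := by positivity
  have hin : |inner ℝ z η| ≤ ‖z‖ * (δ * ‖z‖) :=
    (abs_real_inner_le_norm z η).trans (mul_le_mul_of_nonneg_left hη hzp.le)
  -- With this `α`, `q(1 ± α)` is `‖z ± η‖² + σ²` without the term `‖η‖²`, whose omission is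
  -- harmless because the power is negative.
  refine perturbed_rpow_add_le (α := 2 * inner ℝ z η / (‖z‖ ^ 2 + σ ^ 2)) hp1 hp2 hδ ?_ h₁ h₂ hq ?_ ?_
  · rw [abs_div, abs_of_pos hq, div_le_iff₀ hq, abs_mul, abs_two]
    nlinarith [mul_nonneg hδ0 (sq_nonneg σ)]
  · rw [mul_add, mul_div_cancel₀ _ hq.ne', norm_add_sq_real]
    nlinarith [sq_nonneg ‖η‖]
  · rw [mul_sub, mul_div_cancel₀ _ hq.ne', norm_sub_sq_real]
    nlinarith [sq_nonneg ‖η‖]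

/-! ### Submodularity of the interaction. -/

/-- The inner points are convex combinations of the outer ones with the two weights exchanged, so
adding the two convexity inequalities gives the claim. -/
lemma _root_.StrictConvexOn.add_lt_add_of_add_eq {f : ℝ → ℝ} (hf : StrictConvexOn ℝ univ f)
    {x₁ x₂ x₃ x₄ : ℝ} (h₁₂ : x₁ < x₂) (h₂₄ : x₂ < x₄) (h : x₂ + x₃ = x₁ + x₄) :
    f x₂ + f x₃ < f x₁ + f x₄ := by
  have hd : 0 < x₄ - x₁ := by linarith
  have hl : 0 < (x₄ - x₂) / (x₄ - x₁) := div_pos (by linarith) hd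
  have hr : 0 < (x₂ - x₁) / (x₄ - x₁) := div_pos (by linarith) hd
  have hsum : (x₄ - x₂) / (x₄ - x₁) + (x₂ - x₁) / (x₄ - x₁) = 1 := by field_simp; ring
  have e₂ : (x₄ - x₂) / (x₄ - x₁) * x₁ + (x₂ - x₁) / (x₄ - x₁) * x₄ = x₂ := by
    field_simp; ring
  have e₃ : (x₂ - x₁) / (x₄ - x₁) * x₁ + (x₄ - x₂) / (x₄ - x₁) * x₄ = x₃ := by
    rw [show x₃ = x₁ + x₄ - x₂ by linarith]; field_simp; ring
  have k₂ := hf.2 (mem_univ x₁) (mem_univ x₄) (by linarith) hl hr hsum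
  have k₃ := hf.2 (mem_univ x₁) (mem_univ x₄) (by linarith) hr hl (by linarith)
  simp only [smul_eq_mul] at k₂ k₃
  rw [e₂] at k₂
  rw [e₃] at k₃
  have : (x₄ - x₂) / (x₄ - x₁) = 1 - (x₂ - x₁) / (x₄ - x₁) := by linarith
  rw [this] at k₂ k₃
  linarith

/-- Both `a - b'` and `a' - b` lie strictly between `a - b` and `a' - b'`, and the two pairs have
the same sum. -/
lemma F_cross_lt {n : ℕ} {s : ℝ} {a b a' b' : ℝ} (ha : a < a') (hb : b' < b)
    {x : EuclideanSpace ℝ (Fin n)} (hx : x ≠ 0) :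
    F n s (a - b') x + F n s (a' - b) x < F n s (a - b) x + F n s (a' - b') x := by
  have hr : 0 < ‖x‖ := norm_pos_iff.2 hx
  simp only [F, ← mul_add]
  refine mul_lt_mul_of_pos_left ?_ (by positivity)
  refine (strictConvexOn_GG n s).add_lt_add_of_add_eq ?_ ?_ (by ring)
  · gcongr
  · gcongr

/-- Submodularity of `a, b ↦ F(a - b, x)`. -/
lemma F_min_max_le {n : ℕ} {s : ℝ} (a b a' b' : ℝ) (x : EuclideanSpace ℝ (Fin n)) :
    F n s (min a a' - min b b') x + F n s (max a a' - max b b') x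
      ≤ F n s (a - b) x + F n s (a' - b') x := by
  rcases eq_or_ne x 0 with rfl | hx
  · simp [F, GG_zero]
  have key : ∀ c d c' d' : ℝ, c ≤ c' → d' ≤ d →
      F n s (c - d') x + F n s (c' - d) x ≤ F n s (c - d) x + F n s (c' - d') x := by
    intro c d c' d' h1 h2
    rcases h1.eq_or_lt with rfl | h1
    · rw [add_comm]
    rcases h2.eq_or_lt with rfl | h2
    · rfl
    exact (F_cross_lt h1 h2 hx).le
  rcases le_total a a' with h | h <;> rcases le_total b b' with h' | h' <;> simp only [h, h',
    min_eq_left, min_eq_right, max_eq_left, max_eq_right]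
  · rfl
  · exact key _ _ _ _ h h'
  · have := key _ _ _ _ h h'
    linarith
  · rw [add_comm]

/-! ### Shears and change of variables. -/

section Shear

variable {E : Type*} [NormedAddCommGroup E] [NormedSpace ℝ E]

/-- The map `x ↦ x + ψ(x) e`. -/
def shear (ψ : E → ℝ) (e : E) (x : E) : E := x + ψ x • e

variable {ψ : E → ℝ} {e : E} {δ : ℝ}

lemma abs_fderiv_apply_le (he : ‖e‖ = 1)
    (hψ : ∀ x y, |ψ x - ψ y| ≤ δ * ‖x - y‖) (x : E) : |fderiv ℝ ψ x e| ≤ δ := by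
  have h1 := norm_fderiv_le_of_lip' ℝ (x₀ := x) (f := ψ) (C := δ) (by
    have := (abs_nonneg _).trans (hψ e 0)
    simpa [he] using this) (Filter.Eventually.of_forall fun y => hψ y x)
  have h2 := (fderiv ℝ ψ x).le_opNorm e
  rw [he, mul_one, Real.norm_eq_abs] at h2
  linarith

variable [FiniteDimensional ℝ E]

/-- A perturbation of the identity with Lipschitz constant below `1` is a global homeomorphism. -/
lemma exists_homeomorph_shear (he : ‖e‖ = 1) (hδ : δ < 1)
    (hψ : ∀ x y, |ψ x - ψ y| ≤ δ * ‖x - y‖) : ∃ Φ : E ≃ₜ E, ∀ x, Φ x = shear ψ e x := by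
  have hnt : Nontrivial E := ⟨e, 0, by rintro rfl; simp at he⟩
  have hδ0 : 0 ≤ δ := by
    have := (abs_nonneg _).trans (hψ e 0)
    simpa [he] using this
  have happ : ApproximatesLinearOn (shear ψ e) ((ContinuousLinearEquiv.refl ℝ E : E ≃L[ℝ] E) : E →L[ℝ] E)
      univ ⟨δ, hδ0⟩ := by
    intro x _ y _
    simp only [shear, ContinuousLinearEquiv.coe_refl, ContinuousLinearMap.coe_id', id]
    have : x + ψ x • e - (y + ψ y • e) - (x - y) = (ψ x - ψ y) • e := by
      rw [sub_smul]; abel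
    rw [this, norm_smul, he, mul_one]
    exact hψ x y
  refine ⟨happ.toHomeomorph _ (Or.inr ?_), fun x => rfl⟩
  have : ‖((ContinuousLinearEquiv.refl ℝ E).symm : E →L[ℝ] E)‖₊ = 1 := by
    ext
    exact ContinuousLinearMap.norm_id
  rw [this, inv_one]
  exact_mod_cast hδ

variable [MeasurableSpace E] [BorelSpace E]

/-- The derivative is a rank-one perturbation of the identity, so its determinant is exactly `1 +
∂ₑψ`. It is affine in `ψ`, which is what lets the first-order terms of opposite shears cancel; `δ <
1` makes it positive. -/
lemma lintegral_comp_shear_mul (μ : Measure E) [μ.IsAddHaarMeasure] (he : ‖e‖ = 1) (hδ : δ < 1)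
    (hψ : ∀ x y, |ψ x - ψ y| ≤ δ * ‖x - y‖) (hd : Differentiable ℝ ψ) (h : E → ENNReal) :
    ∫⁻ x, ENNReal.ofReal (1 + fderiv ℝ ψ x e) * h (shear ψ e x) ∂μ = ∫⁻ x, h x ∂μ := by
  obtain ⟨Φ, hΦ⟩ := exists_homeomorph_shear he hδ hψ
  have hΦ' : (Φ : E → E) = shear ψ e := funext hΦ
  have hder : ∀ x ∈ univ, HasFDerivWithinAt (shear ψ e)
      (ContinuousLinearMap.id ℝ E + (fderiv ℝ ψ x).smulRight e) univ x := fun x _ =>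
    ((hasFDerivAt_id x).add ((hd x).hasFDerivAt.smul_const e)).hasFDerivWithinAt
  have hinj : InjOn (shear ψ e) univ := by rw [← hΦ']; exact Φ.injective.injOn
  have hrange : shear ψ e '' univ = univ := by
    rw [← hΦ', image_univ, Φ.surjective.range_eq]
  have := lintegral_image_eq_lintegral_abs_det_fderiv_mul μ MeasurableSet.univ hder hinj h
  rw [hrange, setLIntegral_univ, setLIntegral_univ] at this
  rw [this]
  refine lintegral_congr fun x => ?_
  congr 2
  have hdet : (ContinuousLinearMap.id ℝ E + (fderiv ℝ ψ x).smulRight e).det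
      = 1 + fderiv ℝ ψ x e := by
    have := LinearMap.transvection.det (fderiv ℝ ψ x : E →ₗ[ℝ] ℝ) e
    rw [ContinuousLinearMap.det]
    rw [← ContinuousLinearMap.coe_coe (fderiv ℝ ψ x), ← this]
    congr 1
  rw [hdet, abs_of_nonneg]
  have := neg_le_of_abs_le (abs_fderiv_apply_le he hψ x)
  linarith

lemma lintegral_lintegral_comp_shear_mul (μ : Measure E) [μ.IsAddHaarMeasure] (he : ‖e‖ = 1)
    (hδ : δ < 1) (hψ : ∀ x y, |ψ x - ψ y| ≤ δ * ‖x - y‖) (hd : Differentiable ℝ ψ)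
    (h : E → E → ENNReal) :
    ∫⁻ x, ∫⁻ y, ENNReal.ofReal ((1 + fderiv ℝ ψ x e) * (1 + fderiv ℝ ψ y e)) *
      h (shear ψ e x) (shear ψ e y) ∂μ ∂μ = ∫⁻ x, ∫⁻ y, h x y ∂μ ∂μ := by
  rw [← lintegral_comp_shear_mul μ he hδ hψ hd (fun x => ∫⁻ y, h x y ∂μ)]
  refine lintegral_congr fun x => ?_
  rw [← lintegral_comp_shear_mul μ he hδ hψ hd (h (shear ψ e x)),
    ← lintegral_const_mul' _ _ ENNReal.ofReal_ne_top]
  refine lintegral_congr fun y => ?_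
  have := abs_le.1 (abs_fderiv_apply_le he hψ x)
  rw [ENNReal.ofReal_mul (by linarith), mul_assoc]

end Shear

/-! ### Energies of sheared and rearranged functions. -/

lemma measurable_F_sub {u : EuclideanSpace ℝ (Fin 2) → ℝ} (hu : Measurable u) (s : ℝ) :
    Measurable fun z : EuclideanSpace ℝ (Fin 2) × EuclideanSpace ℝ (Fin 2) =>
      ENNReal.ofReal (F 2 s (u z.1 - u z.2) (z.1 - z.2)) := by
  refine ENNReal.measurable_ofReal.comp (measurable_F.comp
    (f := fun z : EuclideanSpace ℝ (Fin 2) × EuclideanSpace ℝ (Fin 2) =>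
      (u z.1 - u z.2, z.1 - z.2)) ?_)
  fun_prop

lemma measurableSet_interaction (R : ℝ) :
    MeasurableSet (((Metric.ball (0 : EuclideanSpace ℝ (Fin 2)) R)ᶜ ×ˢ
      (Metric.ball (0 : EuclideanSpace ℝ (Fin 2)) R)ᶜ)ᶜ) :=
  (measurableSet_ball.compl.prod measurableSet_ball.compl).compl

lemma energy_eq_lintegral_lintegral {u : EuclideanSpace ℝ (Fin 2) → ℝ} (hu : Measurable u)
    (s : ℝ) (W : ℝ → ℝ) (R : ℝ) :
    energy 2 s W u R =
      (∫⁻ x, ∫⁻ y, (((Metric.ball (0 : EuclideanSpace ℝ (Fin 2)) R)ᶜ ×ˢ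
        (Metric.ball (0 : EuclideanSpace ℝ (Fin 2)) R)ᶜ)ᶜ).indicator
          (fun z => ENNReal.ofReal (F 2 s (u z.1 - u z.2) (z.1 - z.2))) (x, y))
      + ∫⁻ x, (Metric.ball (0 : EuclideanSpace ℝ (Fin 2)) R).indicator
          (fun x => ENNReal.ofReal (W (u x))) x := by
  rw [energy, lintegral_indicator measurableSet_ball,
    ← lintegral_indicator (measurableSet_interaction R), Measure.volume_eq_prod,
    lintegral_prod _ ((measurable_F_sub hu s).indicator (measurableSet_interaction R)).aemeasurable]

/-- An injective map that fixes every point outside the ball cannot send a point of the ball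
outside. Thus the shear preserves the domain of integration of the energy. -/
lemma shear_mem_ball_iff {ψ : EuclideanSpace ℝ (Fin 2) → ℝ} {e : EuclideanSpace ℝ (Fin 2)} {R : ℝ}
    (hinj : Function.Injective (shear ψ e))
    (h0 : ∀ x ∉ Metric.ball (0 : EuclideanSpace ℝ (Fin 2)) R, ψ x = 0)
    (x : EuclideanSpace ℝ (Fin 2)) :
    shear ψ e x ∈ Metric.ball (0 : EuclideanSpace ℝ (Fin 2)) R ↔
      x ∈ Metric.ball (0 : EuclideanSpace ℝ (Fin 2)) R := by
  have hfix : ∀ y ∉ Metric.ball (0 : EuclideanSpace ℝ (Fin 2)) R, shear ψ e y = y := fun y hy => by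
    simp [shear, h0 y hy]
  constructor <;> intro h
  · by_contra hx
    exact hx (hfix x hx ▸ h)
  · by_contra hx
    have := hinj (hfix _ hx)
    rw [this] at hx
    exact hx h

section

variable {s : ℝ} {W : ℝ → ℝ} {ψ : EuclideanSpace ℝ (Fin 2) → ℝ} {e : EuclideanSpace ℝ (Fin 2)}
  {R δ : ℝ} {u : EuclideanSpace ℝ (Fin 2) → ℝ}

/-- Pulling back by the shear restores the values of `u`; the deformation survives only in the
Jacobians and in the spatial argument of `F`, where the second-order estimate applies. -/
lemma energy_comp_symm_eq {Φ : EuclideanSpace ℝ (Fin 2) ≃ₜ EuclideanSpace ℝ (Fin 2)}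
    (hΦ : ∀ x, Φ x = shear ψ e x) (he : ‖e‖ = 1) (hδ : δ < 1)
    (hψ : ∀ x y, |ψ x - ψ y| ≤ δ * ‖x - y‖) (hd : Differentiable ℝ ψ)
    (h0 : ∀ x ∉ Metric.ball (0 : EuclideanSpace ℝ (Fin 2)) R, ψ x = 0) (hu : Continuous u) :
    energy 2 s W (u ∘ Φ.symm) R =
      (∫⁻ x, ∫⁻ y, ENNReal.ofReal ((1 + fderiv ℝ ψ x e) * (1 + fderiv ℝ ψ y e)) *
        (((Metric.ball (0 : EuclideanSpace ℝ (Fin 2)) R)ᶜ ×ˢ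
        (Metric.ball (0 : EuclideanSpace ℝ (Fin 2)) R)ᶜ)ᶜ).indicator
          (fun z => ENNReal.ofReal
            (F 2 s (u z.1 - u z.2) ((z.1 - z.2) + (ψ z.1 - ψ z.2) • e))) (x, y))
      + ∫⁻ x, ENNReal.ofReal (1 + fderiv ℝ ψ x e) *
        (Metric.ball (0 : EuclideanSpace ℝ (Fin 2)) R).indicator
          (fun x => ENNReal.ofReal (W (u x))) x := by
  have hinj : Function.Injective (shear ψ e) := by
    rw [← funext hΦ]; exact Φ.injective
  have hsymm : ∀ x, Φ.symm (shear ψ e x) = x := fun x => by rw [← hΦ]; simp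
  have hsub : ∀ x y, shear ψ e x - shear ψ e y = (x - y) + (ψ x - ψ y) • e := fun x y => by
    simp only [shear, sub_smul]; abel
  have hmem := shear_mem_ball_iff (e := e) hinj h0
  have hum : Measurable (u ∘ Φ.symm) := (hu.comp Φ.symm.continuous).measurable
  rw [energy_eq_lintegral_lintegral hum]
  congr 1
  · rw [← lintegral_lintegral_comp_shear_mul volume he hδ hψ hd]
    refine lintegral_congr fun x => lintegral_congr fun y => ?_
    congr 1
    have hiff : (shear ψ e x, shear ψ e y) ∈ ((Metric.ball (0 : EuclideanSpace ℝ (Fin 2)) R)ᶜ ×ˢ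
        (Metric.ball (0 : EuclideanSpace ℝ (Fin 2)) R)ᶜ)ᶜ ↔
        (x, y) ∈ ((Metric.ball (0 : EuclideanSpace ℝ (Fin 2)) R)ᶜ ×ˢ
        (Metric.ball (0 : EuclideanSpace ℝ (Fin 2)) R)ᶜ)ᶜ := by
      simp only [mem_compl_iff, mem_prod, hmem]
    by_cases h : (x, y) ∈ ((Metric.ball (0 : EuclideanSpace ℝ (Fin 2)) R)ᶜ ×ˢ
        (Metric.ball (0 : EuclideanSpace ℝ (Fin 2)) R)ᶜ)ᶜ
    · rw [indicator_of_mem h, indicator_of_mem (hiff.2 h)]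
      simp only [Function.comp, hsymm, hsub]
    · rw [indicator_of_notMem h, indicator_of_notMem (hiff.not.2 h)]
  · rw [← lintegral_comp_shear_mul volume he hδ hψ hd]
    refine lintegral_congr fun x => ?_
    congr 1
    by_cases h : x ∈ Metric.ball (0 : EuclideanSpace ℝ (Fin 2)) R
    · rw [indicator_of_mem h, indicator_of_mem ((hmem x).2 h)]
      simp only [Function.comp, hsymm]
    · rw [indicator_of_notMem h, indicator_of_notMem ((hmem x).not.2 h)]

/-- Moving `u` by opposite shears changes the sum of the energies only to second order. -/
lemma energy_shear_add_le (hs0 : 0 < s) (hs1 : s < 1)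
    {Φ Φ' : EuclideanSpace ℝ (Fin 2) ≃ₜ EuclideanSpace ℝ (Fin 2)}
    (hΦ : ∀ x, Φ x = shear ψ e x) (hΦ' : ∀ x, Φ' x = shear (-ψ) e x) (he : ‖e‖ = 1)
    (hδ : δ ≤ 1 / 8)
    (hψ : ∀ x y, |ψ x - ψ y| ≤ δ * ‖x - y‖) (hd : Differentiable ℝ ψ)
    (h0 : ∀ x ∉ Metric.ball (0 : EuclideanSpace ℝ (Fin 2)) R, ψ x = 0) (hu : Continuous u) :
    energy 2 s W (u ∘ Φ.symm) R + energy 2 s W (u ∘ Φ'.symm) R ≤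
      ENNReal.ofReal (2 + 100 * δ ^ 2) * energy 2 s W u R := by
  have hψ' : ∀ x y, |(-ψ) x - (-ψ) y| ≤ δ * ‖x - y‖ := fun x y => by
    rw [Pi.neg_apply, Pi.neg_apply, neg_sub_neg, abs_sub_comm]; exact hψ x y
  have h0' : ∀ x ∉ Metric.ball (0 : EuclideanSpace ℝ (Fin 2)) R, (-ψ) x = 0 := fun x hx => by
    simp [h0 x hx]
  have hD := abs_fderiv_apply_le he hψ
  rw [energy_comp_symm_eq hΦ he (by linarith) hψ hd h0 hu,
    energy_comp_symm_eq hΦ' he (by linarith) hψ' hd.neg h0' hu,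
    energy_eq_lintegral_lintegral hu.measurable, mul_add, add_add_add_comm,
    ← lintegral_const_mul' _ _ ENNReal.ofReal_ne_top,
    ← lintegral_const_mul' _ _ ENNReal.ofReal_ne_top]
  gcongr
  -- The lower integral is superadditive without measurability, so both sheared integrands can be
  -- merged and compared pointwise.
  · refine (le_lintegral_add _ _).trans (lintegral_mono fun x => ?_)
    rw [← lintegral_const_mul' _ _ ENNReal.ofReal_ne_top]
    refine (le_lintegral_add _ _).trans (lintegral_mono fun y => ?_)
    by_cases hz : (x, y) ∈ ((Metric.ball (0 : EuclideanSpace ℝ (Fin 2)) R)ᶜ ×ˢ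
        (Metric.ball (0 : EuclideanSpace ℝ (Fin 2)) R)ᶜ)ᶜ
    · have hx := abs_le.1 (hD x)
      have hy := abs_le.1 (hD y)
      simp only [indicator_of_mem hz, fderiv_neg, neg_apply, Pi.neg_apply,
        ← sub_eq_add_neg]
      have hA : 0 ≤ (1 + fderiv ℝ ψ x e) * (1 + fderiv ℝ ψ y e) :=
        mul_nonneg (by linarith) (by linarith)
      have hB : 0 ≤ (1 - fderiv ℝ ψ x e) * (1 - fderiv ℝ ψ y e) :=
        mul_nonneg (by linarith) (by linarith)
      rw [← ENNReal.ofReal_mul hA, ← ENNReal.ofReal_mul hB, ← ENNReal.ofReal_mul (by positivity),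
        ← ENNReal.ofReal_add (mul_nonneg hA (F_nonneg _ _)) (mul_nonneg hB (F_nonneg _ _))]
      refine ENNReal.ofReal_le_ofReal ?_
      have := perturbed_F_add_le hs0 hs1 hδ (hD x) (hD y) (u x - u y) (z := x - y)
        (η := (ψ x - ψ y) • e) (by rw [norm_smul, he, mul_one]; exact hψ x y)
      convert this using 4
      rw [neg_sub_neg, sub_eq_add_neg (x - y), ← neg_smul, neg_sub]
    · simp [indicator_of_notMem hz]
  -- In the potential term the Jacobians `1 ± ∂ₑψ` add up to exactly `2`.
  · refine (le_lintegral_add _ _).trans (lintegral_mono fun x => ?_)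
    have hx := abs_le.1 (hD x)
    simp only [fderiv_neg, neg_apply]
    rw [← add_mul, ← ENNReal.ofReal_add (by linarith) (by linarith)]
    refine mul_le_mul_left (ENNReal.ofReal_le_ofReal ?_) _
    nlinarith [sq_nonneg δ]

/-- Here `d` is a pointwise gain in the interaction. The potential term gains nothing, since `min`
and `max` only permute the two values at each point. -/
lemma energy_min_max_add_le {v : EuclideanSpace ℝ (Fin 2) → ℝ} (hu : Measurable u)
    (hWu : Measurable fun x => W (u x))
    {d : EuclideanSpace ℝ (Fin 2) × EuclideanSpace ℝ (Fin 2) → ENNReal}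
    (hd : ∀ z ∈ ((Metric.ball (0 : EuclideanSpace ℝ (Fin 2)) R)ᶜ ×ˢ
        (Metric.ball (0 : EuclideanSpace ℝ (Fin 2)) R)ᶜ)ᶜ,
      ENNReal.ofReal (F 2 s (min (u z.1) (v z.1) - min (u z.2) (v z.2)) (z.1 - z.2)) +
        ENNReal.ofReal (F 2 s (max (u z.1) (v z.1) - max (u z.2) (v z.2)) (z.1 - z.2)) + d z ≤
      ENNReal.ofReal (F 2 s (u z.1 - u z.2) (z.1 - z.2)) +
        ENNReal.ofReal (F 2 s (v z.1 - v z.2) (z.1 - z.2))) :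
    energy 2 s W (fun x => min (u x) (v x)) R + energy 2 s W (fun x => max (u x) (v x)) R
      + (∫⁻ z in ((Metric.ball (0 : EuclideanSpace ℝ (Fin 2)) R)ᶜ ×ˢ
        (Metric.ball (0 : EuclideanSpace ℝ (Fin 2)) R)ᶜ)ᶜ, d z)
      ≤ energy 2 s W u R + energy 2 s W v R := by
  unfold energy
  rw [add_add_add_comm, add_right_comm]
  conv_rhs => rw [add_add_add_comm]
  refine add_le_add ?_ ?_
  · refine (add_le_add_left (le_lintegral_add _ _) _).trans ((le_lintegral_add _ _).trans ?_)
    rw [← lintegral_add_left (measurable_F_sub hu s)]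
    exact setLIntegral_mono' (measurableSet_interaction R) hd
  · rw [← lintegral_add_left (f := fun x => ENNReal.ofReal (W (u x)))
      (ENNReal.measurable_ofReal.comp hWu)]
    refine (le_lintegral_add _ _).trans (lintegral_mono fun x => ?_)
    rcases le_total (u x) (v x) with h | h <;> simp [h, add_comm]

end

/-! ### Growth of the energy in large balls. -/

/-- The radial majorant of `|B_R \ (B_R - z)| |z|^{-(2+s)}` after normalisation. -/
def radialMajorant (s r : ℝ) : ℝ := r ^ (-(2 + s)) * min r (r ^ (s / 2))

lemma integrable_radialMajorant {s : ℝ} (hs0 : 0 < s) (hs1 : s < 1) :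
    Integrable fun z : EuclideanSpace ℝ (Fin 2) => radialMajorant s ‖z‖ := by
  rw [integrable_fun_norm_addHaar (μ := volume) (f := radialMajorant s)]
  have hdim : Module.finrank ℝ (EuclideanSpace ℝ (Fin 2)) - 1 = 1 := by simp
  rw [hdim]
  simp only [pow_one, smul_eq_mul]
  have hmeas : Measurable fun y : ℝ => y * radialMajorant s y := by
    unfold radialMajorant; fun_prop
  rw [← Ioc_union_Ioi_eq_Ioi zero_le_one]
  refine IntegrableOn.union ?_ ?_
  · have h1 : IntegrableOn (fun y : ℝ => y ^ (-s)) (Ioc 0 1) :=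
      (intervalIntegrable_iff_integrableOn_Ioc_of_le zero_le_one).1
        (intervalIntegral.intervalIntegrable_rpow' (by linarith))
    refine h1.mono' hmeas.aestronglyMeasurable ?_
    filter_upwards [ae_restrict_mem measurableSet_Ioc] with y hy
    have hy0 : 0 < y := hy.1
    have hp : 0 ≤ y * radialMajorant s y := by unfold radialMajorant; positivity
    rw [Real.norm_of_nonneg hp]
    calc y * radialMajorant s y ≤ y * (y ^ (-(2 + s)) * y) := by
          unfold radialMajorant; gcongr; exact min_le_left _ _
      _ = y ^ (-s) := by
          rw [show -s = 1 + (-(2 + s) + 1) by ring, Real.rpow_add hy0, Real.rpow_add hy0,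
            Real.rpow_one]
  · have h1 : IntegrableOn (fun y : ℝ => y ^ (-1 - s / 2)) (Ioi 1) :=
      integrableOn_Ioi_rpow_of_lt (by linarith) zero_lt_one
    refine h1.mono' hmeas.aestronglyMeasurable ?_
    filter_upwards [ae_restrict_mem measurableSet_Ioi] with y hy
    have hy0 : 0 < y := zero_lt_one.trans hy
    have hp : 0 ≤ y * radialMajorant s y := by unfold radialMajorant; positivity
    rw [Real.norm_of_nonneg hp]
    calc y * radialMajorant s y ≤ y * (y ^ (-(2 + s)) * y ^ (s / 2)) := by
          unfold radialMajorant; gcongr; exact min_le_right _ _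
      _ = y ^ (-1 - s / 2) := by
          rw [show -1 - s / 2 = 1 + (-(2 + s) + s / 2) by ring, Real.rpow_add hy0,
            Real.rpow_add hy0, Real.rpow_one]

/-- Since `min 1 y ≤ y^(s/2)`, a factor `R^(-s/2)` can be extracted while leaving a majorant
integrable at infinity. The loss from the natural rate `R^(-s)` is harmless: any negative power
suffices. -/
lemma min_one_div_le {s r R : ℝ} (hs0 : 0 < s) (hs1 : s < 1) (hr : 0 < r) (hR : 1 ≤ R) :
    min 1 (r / R) ≤ R ^ (-(s / 2)) * min r (r ^ (s / 2)) := by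
  have hR0 : 0 < R := by linarith
  have hle : r / R ≤ R ^ (-(s / 2)) * r := by
    rw [div_eq_inv_mul, ← Real.rpow_neg_one]
    gcongr
    · linarith
  rw [mul_min_of_nonneg _ _ (by positivity)]
  refine le_min ((min_le_right _ _).trans hle) ?_
  have : R ^ (-(s / 2)) * r ^ (s / 2) = (r / R) ^ (s / 2) := by
    rw [Real.div_rpow hr.le hR0.le, Real.rpow_neg hR0.le]; field_simp
  rw [this]
  rcases le_total (r / R) 1 with h | h
  · refine (min_le_right _ _).trans ?_
    have := Real.rpow_le_rpow_of_exponent_ge (x := r / R) (by positivity) h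
      (show s / 2 ≤ 1 by linarith)
    simpa using this
  · exact (min_le_left _ _).trans (Real.one_le_rpow h (by linarith))

lemma volume_ball_sub_le {R : ℝ} (hR : 1 ≤ R) (z : EuclideanSpace ℝ (Fin 2)) :
    volume {x : EuclideanSpace ℝ (Fin 2) |
      x ∈ Metric.ball (0 : EuclideanSpace ℝ (Fin 2)) R ∧
        x - z ∉ Metric.ball (0 : EuclideanSpace ℝ (Fin 2)) R} ≤
      ENNReal.ofReal (2 * Real.pi * R ^ 2 * min 1 (‖z‖ / R)) := by
  have hR0 : 0 < R := by linarith
  have hball : ∀ r : ℝ, 0 ≤ r → volume (Metric.ball (0 : EuclideanSpace ℝ (Fin 2)) r)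
      = ENNReal.ofReal (Real.pi * r ^ 2) := fun r hr => by
    rw [EuclideanSpace.volume_ball_fin_two, ENNReal.ofReal_mul Real.pi_pos.le,
      ENNReal.ofReal_pow hr, mul_comm]
  rcases le_total R ‖z‖ with h | h
  · have : (1 : ℝ) ≤ ‖z‖ / R := by rwa [le_div_iff₀ hR0, one_mul]
    rw [min_eq_left this]
    refine (measure_mono (fun x hx => hx.1)).trans ?_
    rw [hball R hR0.le]
    refine ENNReal.ofReal_le_ofReal ?_
    have := Real.pi_pos
    nlinarith [mul_pos this (sq_pos_of_pos hR0)]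
  · have : ‖z‖ / R ≤ 1 := by rwa [div_le_iff₀ hR0, one_mul]
    rw [min_eq_right this]
    -- The points that leave the ball lie in an annulus of width `‖z‖`, whose area is at most
    -- `2πR‖z‖`.
    have hsub : {x : EuclideanSpace ℝ (Fin 2) |
      x ∈ Metric.ball (0 : EuclideanSpace ℝ (Fin 2)) R ∧
        x - z ∉ Metric.ball (0 : EuclideanSpace ℝ (Fin 2)) R} ⊆
        Metric.ball 0 R \ Metric.ball 0 (R - ‖z‖) := by
      rintro x ⟨h1, h2⟩
      refine ⟨h1, fun h3 => h2 ?_⟩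
      rw [mem_ball_zero_iff] at h3 ⊢
      have := norm_sub_le x z
      linarith
    refine (measure_mono hsub).trans ?_
    rw [measure_sdiff (Metric.ball_subset_ball (by linarith [norm_nonneg z]))
      measurableSet_ball.nullMeasurableSet measure_ball_lt_top.ne, hball R hR0.le,
      hball _ (by linarith), ← ENNReal.ofReal_sub _ (by positivity)]
    refine ENNReal.ofReal_le_ofReal ?_
    have e : 2 * Real.pi * R ^ 2 * (‖z‖ / R) = 2 * Real.pi * R * ‖z‖ := by field_simp
    rw [e]
    have := mul_nonneg Real.pi_pos.le (sq_nonneg ‖z‖)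
    nlinarith

/-- The fractional perimeter of a large ball. -/
lemma lintegral_ball_interaction_le {s : ℝ} (hs0 : 0 < s) (hs1 : s < 1) :
    ∃ C : ℝ, 0 ≤ C ∧ ∀ R : ℝ, 1 ≤ R →
      ∫⁻ x : EuclideanSpace ℝ (Fin 2), ∫⁻ y : EuclideanSpace ℝ (Fin 2),
        {z : EuclideanSpace ℝ (Fin 2) × EuclideanSpace ℝ (Fin 2) | z.1 ∈ Metric.ball (0 : EuclideanSpace ℝ (Fin 2)) R ∧
          z.2 ∉ Metric.ball (0 : EuclideanSpace ℝ (Fin 2)) R}.indicator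
          (fun z => ENNReal.ofReal (‖z.1 - z.2‖ ^ (-(2 + s)))) (x, y)
      ≤ ENNReal.ofReal (C * R ^ (2 - s / 2)) := by
  set I := ∫ z : EuclideanSpace ℝ (Fin 2), radialMajorant s ‖z‖ with hI
  have hnn : ∀ r : ℝ, 0 ≤ r → 0 ≤ radialMajorant s r := fun r hr => by
    unfold radialMajorant; positivity
  refine ⟨2 * Real.pi * I, by
    have : 0 ≤ I := integral_nonneg fun z => hnn _ (norm_nonneg _)
    positivity, fun R hR => ?_⟩
  have hR0 : 0 < R := by linarith
  set T := {z : EuclideanSpace ℝ (Fin 2) × EuclideanSpace ℝ (Fin 2) | z.1 ∈ Metric.ball (0 : EuclideanSpace ℝ (Fin 2)) R ∧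
          z.2 ∉ Metric.ball (0 : EuclideanSpace ℝ (Fin 2)) R} with hT
  have hTm : MeasurableSet T :=
    (measurable_fst measurableSet_ball).inter (measurable_snd measurableSet_ball.compl)
  set k : EuclideanSpace ℝ (Fin 2) × EuclideanSpace ℝ (Fin 2) → ENNReal :=
    T.indicator (fun z => ENNReal.ofReal (‖z.1 - z.2‖ ^ (-(2 + s)))) with hk
  have hkm : Measurable k := by
    refine Measurable.indicator ?_ hTm
    fun_prop
  -- Integrating over `x` at fixed displacement `z = x - y` turns the double integral into a radial
  -- one weighted by `|B_R \ (B_R + z)|`.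
  calc ∫⁻ x, ∫⁻ y, k (x, y) = ∫⁻ x, ∫⁻ z, k (x, x - z) := by
        refine lintegral_congr fun x => ?_
        rw [lintegral_sub_left_eq_self (fun y => k (x, y)) x]
    _ = ∫⁻ z, ∫⁻ x, k (x, x - z) := by
        rw [lintegral_lintegral_swap]
        exact (hkm.comp (by fun_prop : Measurable fun q : EuclideanSpace ℝ (Fin 2) × EuclideanSpace ℝ (Fin 2) => (q.1, q.1 - q.2))).aemeasurable
    _ ≤ ∫⁻ z : EuclideanSpace ℝ (Fin 2), ENNReal.ofReal (2 * Real.pi * R ^ (2 - s / 2)) *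
          ENNReal.ofReal (radialMajorant s ‖z‖) := by
        refine lintegral_mono_ae ?_
        have hne : ∀ᵐ z : EuclideanSpace ℝ (Fin 2), z ≠ 0 := by
          simp [ae_iff]
        filter_upwards [hne] with z hz
        have hr : 0 < ‖z‖ := norm_pos_iff.2 hz
        have hset : MeasurableSet {x : EuclideanSpace ℝ (Fin 2) |
            x ∈ Metric.ball (0 : EuclideanSpace ℝ (Fin 2)) R ∧
            x - z ∉ Metric.ball (0 : EuclideanSpace ℝ (Fin 2)) R} :=
          (measurableSet_ball).inter ((measurable_id.sub_const z) measurableSet_ball.compl)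
        have h1 : ∀ x, k (x, x - z) = {x : EuclideanSpace ℝ (Fin 2) |
            x ∈ Metric.ball (0 : EuclideanSpace ℝ (Fin 2)) R ∧
            x - z ∉ Metric.ball (0 : EuclideanSpace ℝ (Fin 2)) R}.indicator
            (fun _ => ENNReal.ofReal (‖z‖ ^ (-(2 + s)))) x := by
          intro x
          by_cases hx : x ∈ {x : EuclideanSpace ℝ (Fin 2) |
              x ∈ Metric.ball (0 : EuclideanSpace ℝ (Fin 2)) R ∧
              x - z ∉ Metric.ball (0 : EuclideanSpace ℝ (Fin 2)) R}
          · rw [hk, indicator_of_mem (show (x, x - z) ∈ T from hx), indicator_of_mem hx,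
              sub_sub_cancel]
          · rw [hk, indicator_of_notMem (show (x, x - z) ∉ T from hx), indicator_of_notMem hx]
        simp_rw [h1]
        rw [lintegral_indicator_const hset, ← ENNReal.ofReal_mul (by positivity)]
        refine (mul_le_mul_right (volume_ball_sub_le hR z) _).trans ?_
        rw [← ENNReal.ofReal_mul (by positivity)]
        refine ENNReal.ofReal_le_ofReal ?_
        calc ‖z‖ ^ (-(2 + s)) * (2 * Real.pi * R ^ 2 * min 1 (‖z‖ / R))
            ≤ ‖z‖ ^ (-(2 + s)) * (2 * Real.pi * R ^ 2 *
              (R ^ (-(s / 2)) * min ‖z‖ (‖z‖ ^ (s / 2)))) := by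
              gcongr
              exact min_one_div_le hs0 hs1 hr hR
          _ = _ := by
              rw [radialMajorant, sub_eq_add_neg 2 (s / 2), Real.rpow_add hR0, Real.rpow_two]
              ring
    _ = _ := by
        rw [lintegral_const_mul' _ _ ENNReal.ofReal_ne_top,
          ← ofReal_integral_eq_lintegral_ofReal (integrable_radialMajorant hs0 hs1)
            (Filter.Eventually.of_forall fun z => hnn _ (norm_nonneg _)),
          ← ENNReal.ofReal_mul (by positivity)]
        congr 1
        ring

/-- Energy of a minimizer in large balls: compare with the constant `1`. -/
lemma exists_energy_le {s : ℝ} (hs0 : 0 < s) (hs1 : s < 1) {M : ℝ} (hM : 1 ≤ M) {W : ℝ → ℝ}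
    (hW1 : W 1 = 0) {u : EuclideanSpace ℝ (Fin 2) → ℝ} (hub : ∀ x, |u x| ≤ M)
    (hmin : ∀ R : ℝ, 0 < R → IsMinimizer 2 s W u R) :
    ∃ C : ℝ, 0 ≤ C ∧ ∀ R : ℝ, 1 ≤ R →
      energy 2 s W u R ≤ ENNReal.ofReal (C * R ^ (2 - s / 2)) := by
  obtain ⟨C, hC0, hC⟩ := lintegral_ball_interaction_le hs0 hs1
  set K : ℝ := Real.pi / 2 * (2 * M) with hK
  have hK0 : 0 ≤ K := by have := Real.pi_pos; positivity
  refine ⟨2 * K * C, by positivity, fun R hR => ?_⟩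
  have hR0 : 0 < R := by linarith
  obtain ⟨hum, -, hle⟩ := hmin R hR0
  classical
  set B := Metric.ball (0 : EuclideanSpace ℝ (Fin 2)) R with hB
  set v : EuclideanSpace ℝ (Fin 2) → ℝ := B.piecewise (fun _ => 1) u with hv
  have hvm : Measurable v := measurable_const.piecewise measurableSet_ball hum
  have hvin : ∀ x ∈ B, v x = 1 := fun x hx => piecewise_eq_of_mem _ _ _ hx
  have hvout : ∀ x ∉ B, v x = u x := fun x hx => piecewise_eq_of_notMem _ _ _ hx
  have hvM : ∀ x, |v x| ≤ M := fun x => by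
    by_cases hx : x ∈ B
    · rw [hvin x hx]; simpa using hM
    · rw [hvout x hx]; exact hub x
  refine (hle v hvm (Filter.Eventually.of_forall fun x hx => (hvout x hx).symm)).trans ?_
  set T := {z : EuclideanSpace ℝ (Fin 2) × EuclideanSpace ℝ (Fin 2) | z.1 ∈ B ∧ z.2 ∉ B} with hT
  set k : EuclideanSpace ℝ (Fin 2) × EuclideanSpace ℝ (Fin 2) → ENNReal :=
    T.indicator (fun z => ENNReal.ofReal (‖z.1 - z.2‖ ^ (-(2 + s)))) with hk
  have hkm : Measurable k := by
    refine Measurable.indicator (by fun_prop)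
      ((measurable_fst measurableSet_ball).inter (measurable_snd measurableSet_ball.compl))
  have hF : ∀ x y, x ≠ y → ENNReal.ofReal (F 2 s (v x - v y) (x - y)) ≤
      ENNReal.ofReal K * ENNReal.ofReal (‖x - y‖ ^ (-(2 + s))) := by
    intro x y hxy
    rw [← ENNReal.ofReal_mul hK0]
    refine ENNReal.ofReal_le_ofReal ?_
    refine (F_le one_le_two hs0.le _ (sub_ne_zero.2 hxy)).trans ?_
    push_cast
    have := abs_sub (v x) (v y)
    have h1 := hvM x
    have h2 := hvM y
    rw [hK]
    have := Real.pi_pos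
    gcongr
    linarith
  -- Pairs inside the ball do not interact because `v` is constant there, so only pairs separated by
  -- the sphere contribute, in either order.
  have hpt : ∀ x y, (((B)ᶜ ×ˢ (B)ᶜ)ᶜ).indicator
      (fun z => ENNReal.ofReal (F 2 s (v z.1 - v z.2) (z.1 - z.2))) (x, y)
      ≤ ENNReal.ofReal K * (k (x, y) + k (y, x)) := by
    intro x y
    by_cases hx : x ∈ B <;> by_cases hy : y ∈ B
    · simp [indicator, hx, hy, hvin, F_zero]
    · have hxy : x ≠ y := fun h => hy (h ▸ hx)
      simpa [indicator, hx, hy, hk, hT] using hF x y hxy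
    · have hxy : x ≠ y := fun h => hx (h ▸ hy)
      have := hF x y hxy
      rw [norm_sub_rev] at this
      simpa [indicator, hx, hy, hk, hT] using this
    · simp [indicator, hx, hy]
  have hWz : ∀ x, B.indicator (fun x => ENNReal.ofReal (W (v x))) x = 0 := by
    intro x
    by_cases hx : x ∈ B <;> simp [indicator, hx, hvin, hW1]
  rw [energy_eq_lintegral_lintegral hvm]
  simp_rw [← hB, hWz]
  rw [lintegral_zero, add_zero]
  calc _ ≤ ∫⁻ x, ∫⁻ y, ENNReal.ofReal K * (k (x, y) + k (y, x)) :=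
        lintegral_mono fun x => lintegral_mono fun y => hpt x y
    _ = ENNReal.ofReal K * ((∫⁻ x, ∫⁻ y, k (x, y)) + ∫⁻ x, ∫⁻ y, k (y, x)) := by
        rw [← lintegral_add_left hkm.lintegral_prod_right',
          ← lintegral_const_mul' _ _ ENNReal.ofReal_ne_top]
        refine lintegral_congr fun x => ?_
        rw [lintegral_const_mul' _ _ ENNReal.ofReal_ne_top,
          lintegral_add_left (f := fun y => k (x, y)) (hkm.comp measurable_prodMk_left)]
    _ ≤ ENNReal.ofReal K * (ENNReal.ofReal (C * R ^ (2 - s / 2)) +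
          ENNReal.ofReal (C * R ^ (2 - s / 2))) := by
        gcongr
        · exact hC R hR
        · rw [lintegral_lintegral_swap (f := fun x y => k (y, x))
            (hkm.comp measurable_swap).aemeasurable]
          exact hC R hR
    _ = _ := by
        rw [← ENNReal.ofReal_add (by positivity) (by positivity), ← ENNReal.ofReal_mul hK0]
        congr 1
        ring

/-! ### Crossing of a minimizer with its translates. -/

/-- Loss of interaction energy when the crossing values of `u` and `w` are rearranged into
`min u w` and `max u w`. -/
def crossingDeficit (s : ℝ) (u w : EuclideanSpace ℝ (Fin 2) → ℝ)
    (z : EuclideanSpace ℝ (Fin 2) × EuclideanSpace ℝ (Fin 2)) : ℝ :=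
  F 2 s (u z.1 - u z.2) (z.1 - z.2) + F 2 s (w z.1 - w z.2) (z.1 - z.2)
    - (F 2 s (u z.1 - w z.2) (z.1 - z.2) + F 2 s (w z.1 - u z.2) (z.1 - z.2))

lemma crossingDeficit_pos {s : ℝ} {u w : EuclideanSpace ℝ (Fin 2) → ℝ}
    {z : EuclideanSpace ℝ (Fin 2) × EuclideanSpace ℝ (Fin 2)} (h1 : u z.1 < w z.1)
    (h2 : w z.2 < u z.2) : 0 < crossingDeficit s u w z := by
  have hne : z.1 - z.2 ≠ 0 := sub_ne_zero.2 fun h => by rw [h] at h1; exact h1.not_gt h2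
  exact sub_pos.2 (F_cross_lt h1 h2 hne)

lemma measurable_crossingDeficit (s : ℝ) {u w : EuclideanSpace ℝ (Fin 2) → ℝ} (hu : Measurable u)
    (hw : Measurable w) : Measurable (crossingDeficit s u w) := by
  have key : ∀ a b : EuclideanSpace ℝ (Fin 2) → ℝ, Measurable a → Measurable b →
      Measurable fun z : EuclideanSpace ℝ (Fin 2) × EuclideanSpace ℝ (Fin 2) =>
        F 2 s (a z.1 - b z.2) (z.1 - z.2) := fun a b ha hb =>
    measurable_F.comp (f := fun z : EuclideanSpace ℝ (Fin 2) × EuclideanSpace ℝ (Fin 2) =>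
      (a z.1 - b z.2, z.1 - z.2)) (by fun_prop)
  exact ((key u u hu hu).add (key w w hw hw)).sub ((key u w hu hw).add (key w u hw hu))

lemma setLIntegral_crossingDeficit_pos (s : ℝ) {u w : EuclideanSpace ℝ (Fin 2) → ℝ}
    (hu : Measurable u) (hw : Measurable w) {U V : Set (EuclideanSpace ℝ (Fin 2))}
    (hUo : IsOpen U) (hVo : IsOpen V) (hU : U.Nonempty) (hV : V.Nonempty)
    (hUlt : ∀ x ∈ U, u x < w x) (hVlt : ∀ x ∈ V, w x < u x) :
    0 < ∫⁻ z in U ×ˢ V, ENNReal.ofReal (crossingDeficit s u w z) := by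
  rw [setLIntegral_pos_iff (f := fun z => ENNReal.ofReal (crossingDeficit s u w z))
    (ENNReal.measurable_ofReal.comp (measurable_crossingDeficit s hu hw))]
  have : Function.support (fun z => ENNReal.ofReal (crossingDeficit s u w z)) ∩ U ×ˢ V = U ×ˢ V := by
    refine inter_eq_right.2 fun z hz => ?_
    simpa using crossingDeficit_pos (s := s) (hUlt _ hz.1) (hVlt _ hz.2)
  rw [this]
  exact (hUo.prod hVo).measure_pos _ (hU.prod hV)

section

variable {s : ℝ} {W : ℝ → ℝ} {u : EuclideanSpace ℝ (Fin 2) → ℝ}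

/-- One fixed bump is rescaled, so `L` depends on `t` but not on `R` and the slope decays like
`1/R`. -/
lemma exists_cutoff (t : ℝ) (ht : 0 < t) : ∃ L : ℝ, 0 ≤ L ∧ ∀ R : ℝ, 0 < R →
    ∃ ψ : EuclideanSpace ℝ (Fin 2) → ℝ, Differentiable ℝ ψ ∧
      (∀ x y, |ψ x - ψ y| ≤ L / R * ‖x - y‖) ∧
      (∀ x ∉ Metric.ball (0 : EuclideanSpace ℝ (Fin 2)) R, ψ x = 0) ∧
      ∀ x, ‖x‖ ≤ R / 2 → ψ x = t := by
  let φ : ContDiffBump (0 : EuclideanSpace ℝ (Fin 2)) := ⟨1 / 2, 1, by norm_num, by norm_num⟩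
  have hφ : ContDiff ℝ 1 (φ : EuclideanSpace ℝ (Fin 2) → ℝ) := φ.contDiff
  obtain ⟨L, hL⟩ := hφ.lipschitzWith_of_hasCompactSupport φ.hasCompactSupport one_ne_zero
  refine ⟨t * L, by positivity, fun R hR => ⟨fun x => t * φ (R⁻¹ • x), ?_, ?_, ?_, ?_⟩⟩
  · have := hφ.differentiable one_ne_zero
    fun_prop
  · intro x y
    have := hL.dist_le_mul (R⁻¹ • x) (R⁻¹ • y)
    rw [Real.dist_eq, dist_eq_norm, ← smul_sub, norm_smul, norm_inv, Real.norm_of_nonneg hR.le] at this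
    rw [← mul_sub, abs_mul, abs_of_pos ht]
    calc t * |φ (R⁻¹ • x) - φ (R⁻¹ • y)| ≤ t * (L * (R⁻¹ * ‖x - y‖)) := by gcongr
      _ = _ := by ring
  · intro x hx
    rw [mem_ball_zero_iff, not_lt] at hx
    have : φ (R⁻¹ • x) = 0 := φ.zero_of_le_dist (by
      rw [dist_zero_right, norm_smul, norm_inv, Real.norm_of_nonneg hR.le]
      change (1 : ℝ) ≤ _
      rwa [← div_eq_inv_mul, le_div_iff₀ hR, one_mul])
    simp [this]
  · intro x hx
    have : φ (R⁻¹ • x) = 1 := φ.one_of_mem_closedBall (by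
      rw [mem_closedBall_zero_iff, norm_smul, norm_inv, Real.norm_of_nonneg hR.le]
      change _ ≤ (1 : ℝ) / 2
      rw [← div_eq_inv_mul, div_le_iff₀ hR]; linarith)
    simp [this]

/-- If `u` and its translate cross on `U ×ˢ V`, the loss of energy there is controlled by the
second-order defect of the translation cut off at scale `R`. -/
lemma crossing_le_energy (hs0 : 0 < s) (hs1 : s < 1)
    (hu : Continuous u) (hWu : Measurable fun x => W (u x)) {R : ℝ}
    (hmin : IsMinimizer 2 s W u R) {ψ : EuclideanSpace ℝ (Fin 2) → ℝ}
    {e h : EuclideanSpace ℝ (Fin 2)} {δ : ℝ} (he : ‖e‖ = 1) (hδ : δ ≤ 1 / 8)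
    (hψ : ∀ x y, |ψ x - ψ y| ≤ δ * ‖x - y‖) (hd : Differentiable ℝ ψ)
    (h0 : ∀ x ∉ Metric.ball (0 : EuclideanSpace ℝ (Fin 2)) R, ψ x = 0)
    {U V : Set (EuclideanSpace ℝ (Fin 2))}
    (hUo : IsOpen U) (hVo : IsOpen V)
    (hUR : U ⊆ Metric.ball 0 R)
    (hUψ : ∀ x ∈ U, ψ (x - h) • e = h) (hVψ : ∀ x ∈ V, ψ (x - h) • e = h)
    (hUlt : ∀ x ∈ U, u x < u (x - h)) (hVlt : ∀ x ∈ V, u (x - h) < u x) :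
    ∫⁻ z in U ×ˢ V, ENNReal.ofReal (crossingDeficit s u (fun x => u (x - h)) z) ≤
      ENNReal.ofReal (100 * δ ^ 2) * energy 2 s W u R := by
  have hψ' : ∀ x y, |(-ψ) x - (-ψ) y| ≤ δ * ‖x - y‖ := fun x y => by
    rw [Pi.neg_apply, Pi.neg_apply, neg_sub_neg, abs_sub_comm]; exact hψ x y
  obtain ⟨Φ, hΦ⟩ := exists_homeomorph_shear he (by linarith) hψ
  obtain ⟨Φ', hΦ'⟩ := exists_homeomorph_shear he (by linarith) hψ'
  obtain ⟨-, hfin, hle⟩ := hmin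
  set E := energy 2 s W u R with hE
  have hout : ∀ x ∉ Metric.ball (0 : EuclideanSpace ℝ (Fin 2)) R, Φ.symm x = x := fun x hx => by
    rw [Homeomorph.symm_apply_eq, hΦ, shear, h0 x hx]; simp
  have hout' : ∀ x ∉ Metric.ball (0 : EuclideanSpace ℝ (Fin 2)) R, Φ'.symm x = x := fun x hx => by
    rw [Homeomorph.symm_apply_eq, hΦ', shear, Pi.neg_apply, h0 x hx]; simp
  have hin : ∀ x, ψ (x - h) • e = h → Φ.symm x = x - h := fun x hx => by
    rw [Homeomorph.symm_apply_eq, hΦ, shear, hx, sub_add_cancel]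
  have hvc : Continuous (u ∘ Φ.symm) := hu.comp Φ.symm.continuous
  have hvc' : Continuous (u ∘ Φ'.symm) := hu.comp Φ'.symm.continuous
  have hsum := energy_shear_add_le (W := W) hs0 hs1 hΦ hΦ' he hδ hψ hd h0 hu
  -- The opposite shear enters only through this lower bound, which turns the estimate on the sum
  -- into an upper bound for the energy of `u ∘ Φ.symm`.
  have hE' : E ≤ energy 2 s W (u ∘ Φ'.symm) R := hle _ hvc'.measurable
    (Filter.Eventually.of_forall fun x hx => by simp [hout' x hx])
  have hEmin : E ≤ energy 2 s W (fun x => min (u x) ((u ∘ Φ.symm) x)) R :=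
    hle _ (hu.min hvc).measurable (Filter.Eventually.of_forall fun x hx => by simp [hout x hx])
  have hEmax : E ≤ energy 2 s W (fun x => max (u x) ((u ∘ Φ.symm) x)) R :=
    hle _ (hu.max hvc).measurable (Filter.Eventually.of_forall fun x hx => by simp [hout x hx])
  set w : EuclideanSpace ℝ (Fin 2) → ℝ := fun x => u (x - h) with hw
  have hUVm : MeasurableSet (U ×ˢ V) := hUo.measurableSet.prod hVo.measurableSet
  have hmm := energy_min_max_add_le (s := s) (W := W) (R := R) (v := u ∘ Φ.symm) hu.measurable hWu
    (d := (U ×ˢ V).indicator fun z => ENNReal.ofReal (crossingDeficit s u w z)) (by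
      intro z _
      by_cases hz : z ∈ U ×ˢ V
      · have e1 : (u ∘ Φ.symm) z.1 = w z.1 := by simp [hin _ (hUψ _ hz.1), hw]
        have e2 : (u ∘ Φ.symm) z.2 = w z.2 := by simp [hin _ (hVψ _ hz.2), hw]
        have l1 : u z.1 < w z.1 := hUlt _ hz.1
        have l2 : w z.2 < u z.2 := hVlt _ hz.2
        rw [indicator_of_mem hz, e1, e2, min_eq_left l1.le, min_eq_right l2.le, max_eq_right l1.le,
          max_eq_left l2.le, ← ENNReal.ofReal_add (F_nonneg _ _) (F_nonneg _ _),
          ← ENNReal.ofReal_add (add_nonneg (F_nonneg _ _) (F_nonneg _ _))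
            (crossingDeficit_pos l1 l2).le,
          ← ENNReal.ofReal_add (F_nonneg _ _) (F_nonneg _ _), crossingDeficit, add_sub_cancel]
      · rw [indicator_of_notMem hz, add_zero, ← ENNReal.ofReal_add (F_nonneg _ _) (F_nonneg _ _),
          ← ENNReal.ofReal_add (F_nonneg _ _) (F_nonneg _ _)]
        exact ENNReal.ofReal_le_ofReal (F_min_max_le _ _ _ _ _))
  have hsub : U ×ˢ V ⊆ ((Metric.ball (0 : EuclideanSpace ℝ (Fin 2)) R)ᶜ ×ˢ
        (Metric.ball (0 : EuclideanSpace ℝ (Fin 2)) R)ᶜ)ᶜ := fun z hz hz' => hz'.1 (hUR hz.1)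
  rw [setLIntegral_indicator hUVm, inter_eq_left.2 hsub] at hmm
  have hEE : E + E ≠ ⊤ := ENNReal.add_ne_top.2 ⟨hfin.ne, hfin.ne⟩
  -- Adding `2E` to both sides is reversible because `E` is finite.
  rw [← ENNReal.add_le_add_iff_left hEE]
  calc E + E + _ ≤ E + energy 2 s W (u ∘ Φ.symm) R :=
        (add_le_add_left (add_le_add hEmin hEmax) _).trans hmm
    _ ≤ energy 2 s W (u ∘ Φ.symm) R + energy 2 s W (u ∘ Φ'.symm) R := by
        rw [add_comm]; gcongr
    _ ≤ _ := hsum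
    _ = E + E + ENNReal.ofReal (100 * δ ^ 2) * E := by
        rw [ENNReal.ofReal_add zero_le_two (by positivity), add_mul, ← two_mul,
          ENNReal.ofReal_ofNat]

/-- By continuity, failure of both inequalities gives nonempty open sets `U` and `V` with opposite
strict orders. The deficit on `U ×ˢ V` is positive and independent of `R`, against an upper bound
tending to zero. -/
lemma le_or_ge_translate (hs0 : 0 < s) (hs1 : s < 1) {M : ℝ} (hM : 1 ≤ M) (hW1 : W 1 = 0)
    (hWu : Measurable fun x => W (u x)) (hu : Continuous u) (hub : ∀ x, |u x| ≤ M)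
    (hmin : ∀ R : ℝ, 0 < R → IsMinimizer 2 s W u R) (h : EuclideanSpace ℝ (Fin 2)) :
    (∀ x, u x ≤ u (x - h)) ∨ ∀ x, u (x - h) ≤ u x := by
  by_contra! hcon
  obtain ⟨⟨y₀, hy₀⟩, x₀, hx₀⟩ := hcon
  have hh : h ≠ 0 := by rintro rfl; simp at hx₀
  have ht : 0 < ‖h‖ := norm_pos_iff.2 hh
  set e := ‖h‖⁻¹ • h with he_def
  have he : ‖e‖ = 1 := by
    rw [he_def, norm_smul, norm_inv, norm_norm, inv_mul_cancel₀ ht.ne']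
  have hte : ‖h‖ • e = h := smul_inv_smul₀ ht.ne' h
  set r := max ‖x₀‖ ‖y₀‖ + 1 with hr
  have hw : Continuous fun x => u (x - h) := by fun_prop
  set U := {x | u x < u (x - h)} ∩ Metric.ball 0 r with hU
  set V := {x | u (x - h) < u x} ∩ Metric.ball 0 r with hV
  have hUo : IsOpen U := (isOpen_lt hu hw).inter Metric.isOpen_ball
  have hVo : IsOpen V := (isOpen_lt hw hu).inter Metric.isOpen_ball
  have hUn : U.Nonempty := ⟨x₀, hx₀, by
    rw [mem_ball_zero_iff]; linarith [le_max_left ‖x₀‖ ‖y₀‖]⟩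
  have hVn : V.Nonempty := ⟨y₀, hy₀, by
    rw [mem_ball_zero_iff]; linarith [le_max_right ‖x₀‖ ‖y₀‖]⟩
  have hpos := setLIntegral_crossingDeficit_pos s hu.measurable hw.measurable hUo hVo hUn hVn
    (fun x hx => hx.1) (fun x hx => hx.1)
  obtain ⟨C, hC0, hC⟩ := exists_energy_le hs0 hs1 hM hW1 hub hmin
  obtain ⟨L, hL0, hL⟩ := exists_cutoff ‖h‖ ht
  have hr0 : 0 < r := by have := norm_nonneg x₀; have := le_max_left ‖x₀‖ ‖y₀‖; linarith
  -- The condition `8 * L ≤ R` makes the slope at most `1/8`; `2 * (r + ‖h‖) ≤ R` keeps `x - h` in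
  -- the half ball where the cutoff is constant, for every `x` in `U ∪ V`.
  have hbound : ∀ R : ℝ, 1 ≤ R → 8 * L ≤ R → 2 * (r + ‖h‖) ≤ R →
      ∫⁻ z in U ×ˢ V, ENNReal.ofReal (crossingDeficit s u (fun x => u (x - h)) z) ≤
        ENNReal.ofReal (100 * L ^ 2 * C * R ^ (-(s / 2))) := by
    intro R hR1 hR2 hR3
    have hR0 : 0 < R := by linarith
    obtain ⟨ψ, hd, hψ, h0, hone⟩ := hL R hR0
    have hnear : ∀ x ∈ Metric.ball (0 : EuclideanSpace ℝ (Fin 2)) r, ψ (x - h) • e = h := by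
      intro x hx
      rw [mem_ball_zero_iff] at hx
      rw [hone (x - h) ((norm_sub_le _ _).trans (by linarith)), hte]
    refine (crossing_le_energy hs0 hs1 hu hWu (hmin R hR0) he
      (by rw [div_le_iff₀ hR0]; linarith) hψ hd h0 hUo hVo
      (fun x hx => Metric.ball_subset_ball (by linarith) hx.2) (fun x hx => hnear x hx.2)
      (fun x hx => hnear x hx.2) (fun x hx => hx.1) (fun x hx => hx.1)).trans ?_
    refine (mul_le_mul_right (hC R hR1) _).trans ?_
    rw [← ENNReal.ofReal_mul (by positivity)]
    refine ENNReal.ofReal_le_ofReal (le_of_eq ?_)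
    rw [sub_eq_add_neg, Real.rpow_add hR0, Real.rpow_two]
    field_simp
  have hlim : Filter.Tendsto (fun R : ℝ => ENNReal.ofReal (100 * L ^ 2 * C * R ^ (-(s / 2))))
      Filter.atTop (nhds 0) := by
    have h1 := (tendsto_rpow_neg_atTop (y := s / 2) (by linarith)).const_mul (100 * L ^ 2 * C)
    rw [mul_zero] at h1
    simpa using ENNReal.tendsto_ofReal h1
  refine hpos.not_ge (ge_of_tendsto hlim ?_)
  filter_upwards [Filter.eventually_ge_atTop 1, Filter.eventually_ge_atTop (8 * L),
    Filter.eventually_ge_atTop (2 * (r + ‖h‖))] with R h1 h2 h3 using hbound R h1 h2 h3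

end

/-! ### From comparability with translates to one-dimensional symmetry. -/

/-- A continuous function on the plane that is comparable with each of its translates is
one-dimensional. -/
lemma exists_eq_comp_inner_of_le_or_ge_translate {u : EuclideanSpace ℝ (Fin 2) → ℝ}
    (hu : Continuous u)
    (h : ∀ h, (∀ x, u x ≤ u (x - h)) ∨ ∀ x, u (x - h) ≤ u x) :
    ∃ ω : EuclideanSpace ℝ (Fin 2), ‖ω‖ = 1 ∧ ∃ u₀ : ℝ → ℝ, ∀ x, u x = u₀ (inner ℝ ω x) := by
  set A : Set (EuclideanSpace ℝ (Fin 2)) := {h | ∀ x, u x ≤ u (x - h)} with hA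
  have hAc : IsClosed A := by
    rw [hA, ofPred_forall]
    exact isClosed_iInter fun x => isClosed_le continuous_const (by fun_prop)
  have hneg : ∀ h, -h ∈ A ↔ ∀ x, u (x - h) ≤ u x := fun h =>
    ⟨fun hh x => by simpa using hh (x - h), fun hh x => by simpa using hh (x - -h)⟩
  have hor : ∀ h, h ∈ A ∨ -h ∈ A := fun k => (h k).imp id (hneg k).2
  have hmul : ∀ (k : ℕ) (v : EuclideanSpace ℝ (Fin 2)), v ∈ A → ∀ x, u x ≤ u (x - (k : ℝ) • v) := by
    intro k v hv
    induction k with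
    | zero => simp
    | succ k ih =>
      intro x
      refine (ih x).trans ((hv _).trans_eq ?_)
      congr 1
      push_cast
      rw [add_smul, one_smul]; abel
  -- a unit period
  obtain ⟨v, hv1, hvA, hvA'⟩ : ∃ v : EuclideanSpace ℝ (Fin 2), ‖v‖ = 1 ∧ v ∈ A ∧ -v ∈ A := by
    have hrank : 1 < Module.rank ℝ (EuclideanSpace ℝ (Fin 2)) := by
      rw [← Module.finrank_eq_rank]; simp
    have hconn := isPreconnected_sphere hrank (0 : EuclideanSpace ℝ (Fin 2)) 1
    obtain ⟨v₀, hv₀⟩ := exists_norm_eq (EuclideanSpace ℝ (Fin 2)) zero_le_one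
    have hv₀s : v₀ ∈ Metric.sphere (0 : EuclideanSpace ℝ (Fin 2)) 1 := by simpa using hv₀
    have hv₀s' : -v₀ ∈ Metric.sphere (0 : EuclideanSpace ℝ (Fin 2)) 1 := by simpa using hv₀
    have := isPreconnected_closed_iff.1 hconn A (-A) hAc hAc.neg (fun k _ => hor k)
    obtain ⟨v, hv, h1, h2⟩ := this (by
      rcases hor v₀ with h' | h'
      · exact ⟨v₀, hv₀s, h'⟩
      · exact ⟨-v₀, hv₀s', h'⟩) (by
      rcases hor v₀ with h' | h'
      · exact ⟨-v₀, hv₀s', by simpa using h'⟩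
      · exact ⟨v₀, hv₀s, h'⟩)
    exact ⟨v, by simpa using hv, h1, h2⟩
  -- fractions of the period are periods
  have hfrac : ∀ k : ℕ, 0 < k → ∀ x, u (x - (k : ℝ)⁻¹ • v) = u x := by
    intro k hk
    have hk0 : (k : ℝ) ≠ 0 := by positivity
    -- The chain `u x ≤ u (x - a) ≤ ... ≤ u (x - k a) = u x` forces equality throughout.
    have key : ∀ a : EuclideanSpace ℝ (Fin 2), a ∈ A → (∀ x, u (x - (k : ℝ) • a) = u x) →
        ∀ x, u (x - a) = u x := by
      intro a ha hper x
      refine le_antisymm ?_ (ha x)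
      obtain ⟨m, rfl⟩ : ∃ m, k = m + 1 := ⟨k - 1, by omega⟩
      refine (hmul m a ha (x - a)).trans_eq ?_
      rw [← hper x]
      congr 1
      push_cast
      rw [add_smul, one_smul]; abel
    have hv : ∀ x, u (x - v) = u x := fun x => le_antisymm ((hneg v).1 hvA' x) (hvA x)
    rcases hor ((k : ℝ)⁻¹ • v) with h' | h'
    · refine key _ h' fun x => ?_
      rw [smul_inv_smul₀ hk0, hv]
    · have := key _ h' fun x => by
        rw [smul_neg, smul_inv_smul₀ hk0, sub_neg_eq_add]
        simpa using (hv (x + v)).symm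
      intro x
      simpa using (this (x - (k : ℝ)⁻¹ • v)).symm
  have hrat : ∀ q : ℚ, ∀ x, u (x - (q : ℝ) • v) = u x := by
    intro q
    have hden : (0 : ℕ) < q.den := q.den_pos
    have hn : ∀ (m : ℕ) (x), u (x - ((m : ℝ) * (q.den : ℝ)⁻¹) • v) = u x := by
      intro m
      induction m with
      | zero => simp
      | succ m ih =>
        intro x
        rw [← ih x, ← hfrac q.den hden (x - ((m : ℝ) * (q.den : ℝ)⁻¹) • v)]
        congr 1
        push_cast
        rw [add_mul, add_smul, one_mul]; abel
    intro x
    have hq : (q : ℝ) = (q.num : ℝ) * (q.den : ℝ)⁻¹ := by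
      rw [← div_eq_mul_inv]; exact Rat.cast_def q
    rcases Int.eq_nat_or_neg q.num with ⟨m, hm | hm⟩
    · rw [hq, hm]; exact_mod_cast hn m x
    · rw [hq, hm]
      have := hn m (x + ((m : ℝ) * (q.den : ℝ)⁻¹) • v)
      rw [add_sub_cancel_right] at this
      rw [this]
      congr 1
      push_cast
      rw [neg_mul, neg_smul, sub_neg_eq_add]
  have hreal : ∀ (t : ℝ) (x), u (x - t • v) = u x := by
    intro t x
    have := (Rat.denseRange_cast (𝕜 := ℝ)).equalizer (g := fun t : ℝ => u (x - t • v))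
      (h := fun _ => u x) (by fun_prop) continuous_const (funext fun q => hrat q x)
    exact congrFun this t
  obtain ⟨ω, hω1, hωv⟩ : ∃ ω : EuclideanSpace ℝ (Fin 2), ‖ω‖ = 1 ∧
      ∀ x : EuclideanSpace ℝ (Fin 2), x = inner ℝ ω x • ω + inner ℝ v x • v := by
    refine ⟨!₂[-(v 1), v 0], ?_, fun x => ?_⟩
    · have := EuclideanSpace.norm_sq_eq v
      rw [EuclideanSpace.norm_eq]
      rw [hv1] at this
      simp [Fin.sum_univ_two] at this ⊢
      linarith
    · have := EuclideanSpace.norm_sq_eq v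
      rw [hv1] at this
      simp [Fin.sum_univ_two] at this
      ext i
      fin_cases i
      · simp [PiLp.inner_apply, Fin.sum_univ_two]
        linear_combination (x 0) * this
      · simp [PiLp.inner_apply, Fin.sum_univ_two]
        linear_combination (x 1) * this
  refine ⟨ω, hω1, fun t => u (t • ω), fun x => ?_⟩
  have := hreal (inner ℝ v x) x
  rw [← this]
  congr 1
  exact sub_eq_of_eq_add (hωv x)

end FracMeanCurv

end

theorem corollary13 (s : ℝ) (hs0 : 0 < s) (hs1 : s < 1)
    (M : ℝ) (hM : 1 ≤ M)
    (W : ℝ → ℝ) (hW0 : ∀ t, 0 ≤ W t) (hW : ContDiffOn ℝ 2 W (Set.Icc (-M) M))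
    (hW1 : W 1 = 0) (hWm1 : W (-1) = 0)
    (u : EuclideanSpace ℝ (Fin 2) → ℝ) (hu : Continuous u) (hub : ∀ x, |u x| ≤ M)
    (hmin : ∀ R : ℝ, 0 < R → FracMeanCurv.IsMinimizer 2 s W u R) :
    ∃ ω : EuclideanSpace ℝ (Fin 2), ‖ω‖ = 1 ∧
      ∃ u₀ : ℝ → ℝ, ∀ x, u x = u₀ (inner ℝ ω x) := by
  -- `W` is regular only on `[-M, M]`, but `u` takes its values there.
  have hWu : Continuous fun x => W (u x) :=
    hW.continuousOn.comp_continuous hu fun x => abs_le.1 (hub x)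
  exact FracMeanCurv.exists_eq_comp_inner_of_le_or_ge_translate hu
    (FracMeanCurv.le_or_ge_translate hs0 hs1 hM hW1 hWu.measurable hu hub hmin)
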